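/- Let $n\ge 2$. There is a constant $C>0$ depending only on $n$ with the following property. Let $u:\mathbb{R}^n\to\mathbb{R}$ be locally strictly convex (every point has a neighbourhood on which $u$ is strictly convex) and normalized by $u(0)=0$, $Du(0)=0$, and for $s\in\mathbb{R}$ put $\Omega_s=\{x\in\mathbb{R}^n : u(x)<s\}$. Suppose that for some $\gamma>0$ and some $t>0$ $$\int_{\Omega_t}|Du|\;\le\;\gamma\Big(\int_{\Omega_t}|t-u|^{\frac{n}{n-1}}\Big)^{\frac{n-1}{n}},$$ where $Du$ is the gradient of $u$, which exists almost everywhere. Then there is $t'\in(t/3,t/2)$ such that $\Omega_{t'}$ satisfies the $\gamma'$-ball condition with $\gamma'=C\gamma^{n/2}$; in particular $\gamma'$ depends only on $n$ and $\gamma$. Here a bounded convex domain (open set) $\Omega\subset\mathbb{R}^n$ satisfies the $\gamma'$-ball condition, for a number $\gamma'>1$, if there are $x_0\in\mathbb{R}^n$ and $R>0$ with $B_{R/\gamma'}(x_0)\subset\Omega\subset B_{\gamma' R}(x_0)$, where $B_r(x_0)$ is the open ball of radius $r$ about $x_0$. -/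

import Mathlib

/-- A real function on `ℝⁿ` is locally strictly convex if every point has a ball around it
on which the function is strictly convex.  No smoothness is built in; in particular every `C²`
function with positive definite Hessian is locally strictly convex. -/
def LocallyStrictConvex {n : ℕ} (u : EuclideanSpace ℝ (Fin n) → ℝ) : Prop :=
  ∀ x : EuclideanSpace ℝ (Fin n), ∃ r : ℝ, 0 < r ∧ StrictConvexOn ℝ (Metric.ball x r) u

/-- The sub-level set `Ω_t = {x ∈ ℝⁿ | u(x) < t}`. -/
def sublevelSet {n : ℕ} (u : EuclideanSpace ℝ (Fin n) → ℝ) (t : ℝ) :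
    Set (EuclideanSpace ℝ (Fin n)) :=
  {x | u x < t}

/-- The reverse isoperimetric inequality at level `t` with constant `γ`:
`∫_{Ω_t} |Du| ≤ γ (∫_{Ω_t} |t - u|^{n/(n-1)})^{(n-1)/n}`.  A locally strictly convex function is
differentiable almost everywhere, so the value of `gradient u` where `u` is not differentiable
plays no role.  If moreover `u(0) = 0` and `Du(0) = 0`, then `Ω_t` is bounded and `u` is Lipschitz
on it, so that both integrals are finite. -/
def ReverseIsoperimetric {n : ℕ} (u : EuclideanSpace ℝ (Fin n) → ℝ) (γ t : ℝ) : Prop :=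
  ∫ x in sublevelSet u t, ‖gradient u x‖ ≤
    γ * (∫ x in sublevelSet u t, |t - u x| ^ ((n : ℝ) / ((n : ℝ) - 1))) ^
      (((n : ℝ) - 1) / (n : ℝ))

/-- For `γ > 1`, a bounded convex domain `Ω` satisfies the `γ`-ball condition if
`γ⁻¹ B_R ⊆ Ω ⊆ γ B_R` for some ball `B_R = B_R(x₀)`, the dilations being about its center `x₀`. -/
structure SatisfiesBallCondition {n : ℕ} (γ : ℝ) (Ω : Set (EuclideanSpace ℝ (Fin n))) :
    Prop where
  one_lt : 1 < γ
  isOpen : IsOpen Ω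
  convex : Convex ℝ Ω
  isBounded : Bornology.IsBounded Ω
  exists_ball : ∃ (x₀ : EuclideanSpace ℝ (Fin n)) (R : ℝ), 0 < R ∧
    Metric.ball x₀ (γ⁻¹ * R) ⊆ Ω ∧ Ω ⊆ Metric.ball x₀ (γ * R)

open MeasureTheory Metric Set

/-! The inequality bounds the width of `Ω_t` from below in every direction, relative to its volume
`V`. If a functional `⟨g, ·⟩` lies in `[-3, 3]` on `Ω_t`, translation by `7g/|g|²` carries `Ω_{t/2}`
off `Ω_t`, so `u` rises by at least `t/2` along every such segment. Integrating over `Ω_{t/2}` gives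
`|Ω_{t/2}| t/4 ≤ (7/|g|) ∫_{Ω_t} |Du|`. The hypothesis bounds the right side by `(7/|g|) γ t
V^{(n-1)/n}`, while `V ≤ 2ⁿ |Ω_{t/2}|` by convexity; hence `|g| ≤ M` with `M` proportional to `γ
V^{-1/n}` (`ReverseIsoperimetric.norm_le`).

This is applied to the dual basis `gᵢ` of a basis `vᵢ` of maximal determinant in the compact convex
set `L = {u ≤ t/3}`: `|⟨gᵢ, ·⟩| ≤ 1` on `L`, hence `≤ 3` on `Ω_t`. The simplex on `0` and the `vᵢ`
contains a ball of radius of order `1/M`. Cramer's rule and `|det| ≤ nⁿ V` bound the `vᵢ`, hence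
`Ω_t`, by order `V M^{n-1}`. The ratio of the radii is of order `V Mⁿ`, where `V` cancels and `γⁿ`
remains; its square root is the ball constant. -/

/-! ### Convexity, positivity and regularity of `u` -/

/-- If a chord inequality fails, `u` minus the chord has a positive interior maximum on the segment;
strict convexity near that point contradicts maximality. -/
theorem LocallyStrictConvex.convexOn {n : ℕ} {u : EuclideanSpace ℝ (Fin n) → ℝ}
    (hu : LocallyStrictConvex u) (hc : Continuous u) : ConvexOn ℝ univ u := by
  refine ⟨convex_univ, fun x _ y _ a b ha hb hab => ?_⟩
  by_contra! hlt
  set g : ℝ → ℝ := fun s => u (x + s • (y - x)) - (u x + s * (u y - u x)) with hg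
  have hgc : Continuous g := by fun_prop
  obtain ⟨s, hs, hmax⟩ := isCompact_Icc.exists_isMaxOn (nonempty_Icc.2 (zero_le_one' ℝ))
    hgc.continuousOn
  have hpos : 0 < g b := by
    have : x + b • (y - x) = a • x + b • y := by
      rw [← eq_sub_iff_add_eq] at hab; subst hab; module
    simp only [hg, this]
    simp only [smul_eq_mul] at hlt
    rw [← eq_sub_iff_add_eq] at hab; subst hab
    linarith
  have hgs : 0 < g s := hpos.trans_le (hmax ⟨hb, by linarith⟩)
  have h0 : g 0 = 0 := by simp [hg]
  have h1 : g 1 = 0 := by simp [hg]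
  have hs0 : 0 < s := hs.1.lt_of_ne (fun h => by rw [← h, h0] at hgs; exact hgs.false)
  have hs1 : s < 1 := hs.2.lt_of_ne (fun h => by rw [h, h1] at hgs; exact hgs.false)
  have hxy : y - x ≠ 0 := fun h => by
    have : y = x := sub_eq_zero.1 h
    subst this
    simp [hg] at hgs
  obtain ⟨r, hr, hconv⟩ := hu (x + s • (y - x))
  have hn : 0 < ‖y - x‖ := norm_pos_iff.2 hxy
  obtain ⟨d, hd, hd'⟩ := exists_between
    (show 0 < min (min s (1 - s)) (r / ‖y - x‖) by
      apply lt_min (lt_min hs0 (by linarith)) (by positivity))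
  have hd1 := hd'.trans_le ((min_le_left _ _).trans (min_le_left _ _))
  have hd2 := hd'.trans_le ((min_le_left _ _).trans (min_le_right _ _))
  have hd3 : d * ‖y - x‖ < r := (lt_div_iff₀ hn).1 (hd'.trans_le (min_le_right _ _))
  have key := hconv.2
    (show x + (s - d) • (y - x) ∈ _ by rw [mem_ball, dist_eq_norm,
          show x + (s - d) • (y - x) - (x + s • (y - x)) = (-d) • (y - x) by module,
          norm_smul, norm_neg, Real.norm_of_nonneg hd.le]; exact hd3)
    (show x + (s + d) • (y - x) ∈ _ by rw [mem_ball, dist_eq_norm,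
          show x + (s + d) • (y - x) - (x + s • (y - x)) = d • (y - x) by module,
          norm_smul, Real.norm_of_nonneg hd.le]; exact hd3)
    (fun h => by
      have h2 : (2 * d) • (y - x) = 0 := by
        rw [show (2 * d) • (y - x) = (x + (s + d) • (y - x)) - (x + (s - d) • (y - x)) by module, h,
          sub_self]
      rcases smul_eq_zero.1 h2 with h3 | h3
      · linarith
      · exact hxy h3)
    (one_half_pos (α := ℝ)) (one_half_pos (α := ℝ)) (by norm_num)
  have hm1 : g (s - d) ≤ g s := hmax ⟨by linarith, by linarith⟩
  have hm2 : g (s + d) ≤ g s := hmax ⟨by linarith, by linarith⟩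
  have : (1 / 2 : ℝ) • (x + (s - d) • (y - x)) + (1 / 2 : ℝ) • (x + (s + d) • (y - x))
      = x + s • (y - x) := by module
  rw [this] at key
  simp only [hg, smul_eq_mul] at hm1 hm2 key
  linarith

theorem LocallyStrictConvex.continuous {n : ℕ} {u : EuclideanSpace ℝ (Fin n) → ℝ}
    (hu : LocallyStrictConvex u) : Continuous u := by
  rw [continuous_iff_continuousAt]
  intro x
  obtain ⟨r, hr, h⟩ := hu x
  exact (h.convexOn.continuousOn isOpen_ball).continuousAt (ball_mem_nhds x hr)

/-- A convex function lies above its tangent planes. -/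
theorem ConvexOn.apply_add_inner_gradient_le {n : ℕ} {u : EuclideanSpace ℝ (Fin n) → ℝ}
    (hu : ConvexOn ℝ univ u) {x v : EuclideanSpace ℝ (Fin n)} (hx : HasGradientAt u v x)
    (y : EuclideanSpace ℝ (Fin n)) : u x + inner ℝ v (y - x) ≤ u y := by
  have hl : ConvexOn ℝ univ (fun s : ℝ => u (x + s • (y - x))) := by
    have := hu.comp_affineMap (AffineMap.lineMap x y)
    refine this.congr fun s _ => ?_
    simp [AffineMap.lineMap_apply, add_comm]
  have hd : HasDerivAt (fun s : ℝ => u (x + s • (y - x))) (inner ℝ v (y - x)) 0 := by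
    have h1 : HasDerivAt (fun s : ℝ => x + s • (y - x)) (y - x) 0 := by
      simpa using ((hasDerivAt_id (0 : ℝ)).smul_const (y - x)).const_add x
    have h2 : HasFDerivAt u (InnerProductSpace.toDual ℝ _ v) (x + (0 : ℝ) • (y - x)) := by
      simpa using hx.hasFDerivAt
    simpa [Function.comp_def] using h2.comp_hasDerivAt (0 : ℝ) h1
  have := hl.le_slope_of_hasDerivAt (mem_univ 0) (mem_univ 1) zero_lt_one hd
  simp [slope_def_field] at this
  linarith

/-- The tangent plane at `0` gives `u ≥ 0`. A second zero would force `u ≤ 0` on a segment from `0`,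
and strict convexity near `0` would then produce a negative value. -/
theorem LocallyStrictConvex.pos {n : ℕ} {u : EuclideanSpace ℝ (Fin n) → ℝ}
    (hu : LocallyStrictConvex u) (h0 : u 0 = 0) (hg : HasGradientAt u 0 0)
    {x : EuclideanSpace ℝ (Fin n)} (hx : x ≠ 0) : 0 < u x := by
  have hc := hu.convexOn hu.continuous
  have hnn : ∀ y, 0 ≤ u y := fun y => by
    simpa [h0] using hc.apply_add_inner_gradient_le hg y
  refine (hnn x).lt_of_ne fun hux => ?_
  obtain ⟨r, hr, hconv⟩ := hu 0
  have hn : 0 < ‖x‖ := norm_pos_iff.2 hx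
  obtain ⟨d, hd, hd'⟩ := exists_between (show 0 < min 1 (r / ‖x‖) by positivity)
  have hd1 : d < 1 := hd'.trans_le (min_le_left _ _)
  have hd3 : d * ‖x‖ < r := (lt_div_iff₀ hn).1 (hd'.trans_le (min_le_right _ _))
  have hz : u (d • x) ≤ 0 := by
    have := hc.2 (mem_univ x) (mem_univ 0) hd.le (sub_nonneg.2 hd1.le) (by ring)
    simpa [← hux, h0] using this
  have key := hconv.2
    (show d • x ∈ _ by rw [mem_ball_zero_iff, norm_smul, Real.norm_of_nonneg hd.le]; exact hd3)
    (mem_ball_self hr) (smul_ne_zero hd.ne' hx)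
    (one_half_pos (α := ℝ)) (one_half_pos (α := ℝ)) (by norm_num)
  have := hnn ((1 / 2 : ℝ) • d • x + (1 / 2 : ℝ) • (0 : EuclideanSpace ℝ (Fin n)))
  simp only [smul_eq_mul, h0] at key
  linarith

theorem ConvexOn.apply_smul_le {n : ℕ} {u : EuclideanSpace ℝ (Fin n) → ℝ}
    (hu : ConvexOn ℝ univ u) (h0 : u 0 = 0) {c : ℝ} (hc : 0 ≤ c) (hc1 : c ≤ 1)
    (x : EuclideanSpace ℝ (Fin n)) : u (c • x) ≤ c * u x := by
  simpa [h0] using hu.2 (mem_univ x) (mem_univ 0) hc (sub_nonneg.2 hc1) (by ring)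

/-- Convexity and `u 0 = 0` make `u` grow at least linearly along rays beyond the unit sphere, with
slope its positive minimum there. -/
theorem ConvexOn.isBounded_sublevelSet {n : ℕ} (hn : 0 < n) {u : EuclideanSpace ℝ (Fin n) → ℝ}
    (hu : ConvexOn ℝ univ u) (hcont : Continuous u) (h0 : u 0 = 0) (hpos : ∀ x, x ≠ 0 → 0 < u x)
    (t : ℝ) : Bornology.IsBounded (sublevelSet u t) := by
  have : Nonempty (Fin n) := ⟨⟨0, hn⟩⟩
  obtain ⟨z, hz, hmin⟩ := (isCompact_sphere (0 : EuclideanSpace ℝ (Fin n)) 1).exists_isMinOn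
    (NormedSpace.sphere_nonempty.2 zero_le_one) hcont.continuousOn
  have hm : 0 < u z := hpos z (fun h => by simp [h] at hz)
  refine (isBounded_closedBall (x := (0 : EuclideanSpace ℝ (Fin n)))
    (r := max 1 (t / u z))).subset fun x hx => ?_
  rw [mem_closedBall_zero_iff, le_max_iff]
  by_contra! hcon
  obtain ⟨h1, h2⟩ := hcon
  have hx0 : 0 < ‖x‖ := by linarith
  have hs : u z ≤ u (‖x‖⁻¹ • x) := hmin (by
    rw [mem_sphere_zero_iff_norm, norm_smul, norm_inv, norm_norm, inv_mul_cancel₀ hx0.ne'])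
  have := hs.trans (hu.apply_smul_le h0 (by positivity) (inv_le_one_of_one_le₀ h1.le) x)
  rw [inv_mul_eq_div, le_div_iff₀ hx0] at this
  rw [div_lt_iff₀ hm] at h2
  have hx' : u x < t := hx
  linarith

theorem ConvexOn.exists_lipschitzOnWith_ball {n : ℕ} {u : EuclideanSpace ℝ (Fin n) → ℝ}
    (hu : ConvexOn ℝ univ u) (R : ℝ) : ∃ K, LipschitzOnWith K u (ball 0 R) := by
  have h := hu.locallyLipschitz
  obtain ⟨K, hK⟩ := (h.locallyLipschitzOn (s := closedBall 0 R)).exists_lipschitzOnWith_of_compact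
    (isCompact_closedBall 0 R)
  exact ⟨K, hK.mono ball_subset_closedBall⟩

theorem ConvexOn.ae_differentiableAt {n : ℕ} {u : EuclideanSpace ℝ (Fin n) → ℝ}
    (hu : ConvexOn ℝ univ u) : ∀ᵐ x, DifferentiableAt ℝ u x := by
  have h : ∀ᵐ x, ∀ N : ℕ, x ∈ ball (0 : EuclideanSpace ℝ (Fin n)) N →
      DifferentiableWithinAt ℝ u (ball 0 N) x := by
    rw [ae_all_iff]
    intro N
    obtain ⟨K, hK⟩ := hu.exists_lipschitzOnWith_ball N
    exact hK.ae_differentiableWithinAt_of_mem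
  filter_upwards [h] with x hx
  obtain ⟨N, hN⟩ := exists_nat_gt ‖x‖
  have hN' : x ∈ ball (0 : EuclideanSpace ℝ (Fin n)) N := by simpa using hN
  exact (hx N hN').differentiableAt (isOpen_ball.mem_nhds hN')

theorem norm_gradient_eq {n : ℕ} (u : EuclideanSpace ℝ (Fin n) → ℝ)
    (x : EuclideanSpace ℝ (Fin n)) : ‖gradient u x‖ = ‖fderiv ℝ u x‖ := by
  simp [gradient]

theorem isOpen_sublevelSet {n : ℕ} {u : EuclideanSpace ℝ (Fin n) → ℝ} (hu : Continuous u)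
    (t : ℝ) : IsOpen (sublevelSet u t) :=
  isOpen_lt hu continuous_const

theorem ConvexOn.integrableOn_norm_gradient {n : ℕ} {u : EuclideanSpace ℝ (Fin n) → ℝ}
    (hu : ConvexOn ℝ univ u) {s : Set (EuclideanSpace ℝ (Fin n))} (hs : Bornology.IsBounded s)
    (hm : MeasurableSet s) : IntegrableOn (fun x => ‖gradient u x‖) s := by
  obtain ⟨R, hR⟩ := hs.subset_ball 0
  obtain ⟨K, hK⟩ := hu.exists_lipschitzOnWith_ball R
  simp only [norm_gradient_eq]
  refine Measure.integrableOn_of_bounded (M := K) hs.measure_lt_top.ne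
    (measurable_fderiv ℝ u).norm.aestronglyMeasurable ?_
  filter_upwards [ae_restrict_mem hm] with x hx
  rw [norm_norm]
  exact norm_fderiv_le_of_lipschitzOn ℝ (isOpen_ball.mem_nhds (hR hx)) hK

/-! ### Lower bound for `∫ |Du|` by translation -/

/-- A discrete total variation bound: if `u` rises from below `a` to `t` along the segment from `x`
to `x + v`, then the gradient of `u`, sampled along the segment, sees at least half of it. -/
theorem ConvexOn.half_le_sum_gradient {n : ℕ} {u : EuclideanSpace ℝ (Fin n) → ℝ}
    (hu : ConvexOn ℝ univ u) {a t R : ℝ} {v x : EuclideanSpace ℝ (Fin n)} {K : NNReal}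
    (hat : a < t) (hR : sublevelSet u t ⊆ ball 0 R)
    (hK : LipschitzOnWith K u (ball 0 (R + ‖v‖))) {N : ℕ} (hN : 0 < N)
    (hKN : K * ‖v‖ / N ≤ (t - a) / 2) (hx : u x < a) (hxv : t ≤ u (x + v))
    (hd : ∀ j : ℕ, DifferentiableAt ℝ u (x + ((j : ℝ) / N) • v)) :
    (t - a) / 2 ≤ ∑ j ∈ Finset.range N, ‖v‖ / N *
      (sublevelSet u t).indicator (fun y => ‖gradient u y‖) (x + (((j + 1 : ℕ) : ℝ) / N) • v) := by
  classical
  have hN' : (0 : ℝ) < N := by exact_mod_cast hN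
  set F := (sublevelSet u t).indicator (fun y => ‖gradient u y‖) with hF
  have hF0 : ∀ y, 0 ≤ F y := indicator_nonneg fun _ _ => norm_nonneg _
  have hex : ∃ j : ℕ, t ≤ u (x + ((j : ℝ) / N) • v) := ⟨N, by rwa [div_self hN'.ne', one_smul]⟩
  -- `k + 1` is the first grid index at which `u` reaches `t`, so grid points up to `k` lie in the
  -- sublevel set.
  obtain ⟨k, hk⟩ : ∃ k, Nat.find hex = k + 1 := by
    refine Nat.exists_eq_succ_of_ne_zero fun h => ?_
    have := Nat.find_spec hex
    rw [h] at this
    simp at this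
    linarith
  have hkN : k + 1 ≤ N := hk ▸ Nat.find_min' hex (by rwa [div_self hN'.ne', one_smul])
  have hlt : ∀ j ≤ k, u (x + ((j : ℝ) / N) • v) < t := fun j hj =>
    not_le.1 (Nat.find_min hex (by omega))
  have hge : t ≤ u (x + (((k + 1 : ℕ) : ℝ) / N) • v) := hk ▸ Nat.find_spec hex
  have hstep : ∀ j : ℕ, x + (((j + 1 : ℕ) : ℝ) / N) • v =
      x + ((j : ℝ) / N) • v + (1 / (N : ℝ)) • v := fun j => by push_cast; module
  have hnorm : ‖(1 / (N : ℝ)) • v‖ = ‖v‖ / N := by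
    rw [norm_smul, Real.norm_of_nonneg (by positivity)]; ring
  -- The tangent plane at the right endpoint of each grid interval bounds the increment over it from
  -- above, which is why the gradient is sampled there.
  have htel : ∀ j ≤ k, u (x + ((j : ℝ) / N) • v) - u x ≤
      ∑ i ∈ Finset.range j, ‖v‖ / N * F (x + (((i + 1 : ℕ) : ℝ) / N) • v) := by
    intro j
    induction j with
    | zero => simp
    | succ j ih =>
      intro hj
      rw [Finset.sum_range_succ]
      have h1 := ih (by omega)
      have h2 := hu.apply_add_inner_gradient_le (hd (j + 1)).hasGradientAt
        (x + ((j : ℝ) / N) • v)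
      have h3 : F (x + (((j + 1 : ℕ) : ℝ) / N) • v) =
          ‖gradient u (x + (((j + 1 : ℕ) : ℝ) / N) • v)‖ := 
            indicator_of_mem (show _ ∈ sublevelSet u t from hlt _ hj) _
      have h4 := real_inner_le_norm (gradient u (x + (((j + 1 : ℕ) : ℝ) / N) • v))
        ((1 / (N : ℝ)) • v)
      rw [show x + ((j : ℝ) / N) • v - (x + (((j + 1 : ℕ) : ℝ) / N) • v) = -((1 / (N : ℝ)) • v) by
        rw [hstep]; abel, inner_neg_right] at h2
      rw [hnorm] at h4
      rw [h3]
      linarith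
  have hmem : x + ((k : ℝ) / N) • v ∈ ball (0 : EuclideanSpace ℝ (Fin n)) R := hR (hlt k le_rfl)
  rw [mem_ball_zero_iff] at hmem
  -- The step that crosses level `t` is not sampled; by the Lipschitz bound and the choice of `N` it
  -- loses at most half of the rise.
  have hlip := hK.dist_le_mul (x + (((k + 1 : ℕ) : ℝ) / N) • v) (by
      rw [mem_ball_zero_iff, hstep]
      refine (norm_add_le _ _).trans_lt (add_lt_add_of_lt_of_le hmem ?_)
      rw [hnorm]
      exact div_le_self (norm_nonneg _) (by exact_mod_cast hN))
    (x + ((k : ℝ) / N) • v) (by rw [mem_ball_zero_iff]; linarith [norm_nonneg v])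
  rw [dist_eq_norm (x + _), hstep, add_sub_cancel_left, hnorm, ← hstep, Real.dist_eq,
    ← mul_div_assoc] at hlip
  have h5 := (abs_le.1 hlip).2
  calc (t - a) / 2 ≤ u (x + ((k : ℝ) / N) • v) - u x := by linarith
    _ ≤ _ := htel k le_rfl
    _ ≤ _ := Finset.sum_le_sum_of_subset_of_nonneg (Finset.range_subset_range.2 (by omega))
      fun i _ _ => mul_nonneg (by positivity) (hF0 _)

/-- If translation by `v` moves the sublevel set of height `a` out of the one of height `t`, then
`∫ |Du|` over the latter is bounded below. -/
theorem ConvexOn.volume_mul_le_norm_mul_integral_gradient {n : ℕ}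
    {u : EuclideanSpace ℝ (Fin n) → ℝ} (hu : ConvexOn ℝ univ u) (hc : Continuous u) {a t : ℝ}
    (hat : a < t) (hb : Bornology.IsBounded (sublevelSet u t)) {v : EuclideanSpace ℝ (Fin n)}
    (hv : ∀ x, u x < a → t ≤ u (x + v)) :
    volume.real (sublevelSet u a) * ((t - a) / 2) ≤
      ‖v‖ * ∫ x in sublevelSet u t, ‖gradient u x‖ := by
  obtain ⟨R, hR⟩ := hb.subset_ball 0
  obtain ⟨K, hK⟩ := hu.exists_lipschitzOnWith_ball (R + ‖v‖)
  obtain ⟨N, hN⟩ := exists_nat_gt (K * ‖v‖ / ((t - a) / 2))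
  have hN' : (0 : ℝ) < N := lt_of_le_of_lt
    (div_nonneg (by positivity) (by linarith)) hN
  have hmt := (isOpen_sublevelSet hc t).measurableSet
  have hma := (isOpen_sublevelSet hc a).measurableSet
  have hba : Bornology.IsBounded (sublevelSet u a) :=
    hb.subset fun x (hx : u x < a) => hx.trans hat
  set F := (sublevelSet u t).indicator (fun y => ‖gradient u y‖) with hF
  have hF0 : ∀ y, 0 ≤ F y := indicator_nonneg fun _ _ => norm_nonneg _
  have hFi : Integrable F := (integrable_indicator_iff hmt).2 (hu.integrableOn_norm_gradient hb hmt)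
  -- Only countably many translates are sampled, so almost every `x` has all of them at points of
  -- differentiability; no integration along lines is needed.
  have hd : ∀ᵐ x, ∀ j : ℕ, DifferentiableAt ℝ u (x + ((j : ℝ) / N) • v) := by
    rw [ae_all_iff]
    intro j
    exact (measurePreserving_add_right volume (((j : ℝ) / N) • v)).quasiMeasurePreserving.ae
      hu.ae_differentiableAt
  have hFj : ∀ j : ℕ, Integrable (fun x => ‖v‖ / N * F (x + (((j + 1 : ℕ) : ℝ) / N) • v)) :=
    fun j => (hFi.comp_add_right _).const_mul _
  calc volume.real (sublevelSet u a) * ((t - a) / 2)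
      = ∫ x in sublevelSet u a, (t - a) / 2 := by simp
    _ ≤ ∫ x in sublevelSet u a, ∑ j ∈ Finset.range N,
          ‖v‖ / N * F (x + (((j + 1 : ℕ) : ℝ) / N) • v) := by
        refine setIntegral_mono_on_ae (integrableOn_const hba.measure_lt_top.ne)
          (integrable_finsetSum _ fun j _ => hFj j).integrableOn hma ?_
        filter_upwards [hd] with x hx hxa
        exact hu.half_le_sum_gradient hat hR hK (by exact_mod_cast hN')
          (by rw [div_lt_iff₀ (by linarith)] at hN; rw [div_le_iff₀ hN']; linarith) hxa
          (hv x hxa) hx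
    _ ≤ ∫ x, ∑ j ∈ Finset.range N, ‖v‖ / N * F (x + (((j + 1 : ℕ) : ℝ) / N) • v) :=
        setIntegral_le_integral (integrable_finsetSum _ fun j _ => hFj j)
          (Filter.Eventually.of_forall fun x => Finset.sum_nonneg fun j _ =>
            mul_nonneg (by positivity) (hF0 _))
    -- By translation invariance all samples have the same integral.
    _ = ∑ j ∈ Finset.range N, ‖v‖ / N * ∫ x, F x := by
        rw [integral_finsetSum _ fun j _ => hFj j]
        refine Finset.sum_congr rfl fun j _ => ?_
        rw [integral_const_mul, integral_add_right_eq_self F]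
    _ = ‖v‖ * ∫ x in sublevelSet u t, ‖gradient u x‖ := by
        rw [hF, integral_indicator hmt, Finset.sum_const, Finset.card_range, nsmul_eq_mul]
        field_simp

/-! ### Bases of maximal determinant and inscribed simplices -/

/-- `M` times a cofactor is the determinant of `B` with one row replaced by `M` times a unit vector,
whose entries are still at most `M`. The factor `M` on the left avoids the exponent `n - 1`. -/
theorem Matrix.mul_abs_adjugate_le {n : ℕ} (B : Matrix (Fin n) (Fin n) ℝ) {M : ℝ} (hM : 0 < M)
    (hB : ∀ i j, |B i j| ≤ M) (i j : Fin n) :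
    M * |B.adjugate i j| ≤ (n.factorial : ℝ) * M ^ n := by
  have h : M * B.adjugate i j = (B.updateRow j (M • Pi.single i 1)).det := by
    rw [Matrix.det_updateRow_smul, Matrix.adjugate_apply]
  rw [← abs_of_pos hM, ← abs_mul, abs_of_pos hM, h]
  have := Matrix.det_le (A := B.updateRow j (M • Pi.single i 1)) (abv := AbsoluteValue.abs)
    (x := M) (fun a b => by
      rw [AbsoluteValue.abs_apply, Matrix.updateRow_apply]
      split_ifs with h
      · by_cases hb : b = i
        · subst hb; simp [abs_of_pos hM]
        · simp [hb, hM.le]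
      · exact hB a b)
  simpa using this

/-- Cramer's rule in the form `A = det A • adj(A⁻¹)`: a basis is controlled by its determinant and
its dual basis. -/
theorem Matrix.abs_apply_le_of_inv {n : ℕ} {A : Matrix (Fin n) (Fin n) ℝ} (hA : A.det ≠ 0) {M : ℝ}
    (hM : 0 < M) (hB : ∀ i j, |A⁻¹ i j| ≤ M) (i j : Fin n) :
    |A i j| ≤ |A.det| * (n.factorial * M ^ n / M) := by
  have hu : IsUnit A.det := hA.isUnit
  have h : A = A.det • A⁻¹.adjugate := by
    have h1 : A * (A⁻¹ * A⁻¹.adjugate) = A⁻¹.adjugate := by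
      rw [← Matrix.mul_assoc, Matrix.mul_nonsing_inv _ hu, Matrix.one_mul]
    rw [← h1, Matrix.mul_adjugate, Matrix.det_nonsing_inv, Ring.inverse_eq_inv']
    simp [smul_smul, hA]
  have h2 := Matrix.mul_abs_adjugate_le A⁻¹ hM hB i j
  have h3 : A i j = A.det * A⁻¹.adjugate i j := by
    conv_lhs => rw [h]
    simp
  rw [h3, abs_mul]
  gcongr
  rwa [le_div_iff₀ hM, mul_comm]

theorem Convex.sum_smul_mem_of_zero_mem {E ι : Type*} [AddCommGroup E] [Module ℝ E] [Fintype ι]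
    {L : Set E} (hL : Convex ℝ L) (h0 : (0 : E) ∈ L) {w : ι → ℝ} {v : ι → E}
    (hw : ∀ i, 0 ≤ w i) (hw1 : ∑ i, w i ≤ 1) (hv : ∀ i, v i ∈ L) : ∑ i, w i • v i ∈ L := by
  rcases (Finset.sum_nonneg fun i _ => hw i : 0 ≤ ∑ i, w i).eq_or_lt with h | h
  · have : ∀ i, w i = 0 := fun i =>
      (Finset.sum_eq_zero_iff_of_nonneg fun i _ => hw i).1 h.symm i (Finset.mem_univ i)
    simpa [this] using h0
  · have h1 := hL.sum_mem (t := Finset.univ) (w := fun i => w i / ∑ i, w i) (z := v)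
      (fun i _ => div_nonneg (hw i) h.le) (by rw [← Finset.sum_div, div_self h.ne'])
      (fun i _ => hv i)
    have h2 := hL.smul_mem_of_zero_mem h0 h1 ⟨h.le, hw1⟩
    rw [Finset.smul_sum] at h2
    convert h2 using 2 with i
    rw [smul_smul, mul_div_cancel₀ _ h.ne']

/-- The parallelepiped with edges `Aᵢ / n` lies in `L`, since its points are combinations of the
rows with nonnegative weights of sum at most one. -/
theorem Convex.abs_det_le_volume {n : ℕ} (hn : 0 < n) {L : Set (EuclideanSpace ℝ (Fin n))}
    (hL : Convex ℝ L) (h0 : 0 ∈ L) (hb : Bornology.IsBounded L)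
    {A : Matrix (Fin n) (Fin n) ℝ} (hA : ∀ i, WithLp.toLp 2 (A i) ∈ L) :
    |A.det| ≤ (n : ℝ) ^ n * volume.real L := by
  have hn' : (0 : ℝ) < n := by exact_mod_cast hn
  have hsub : Matrix.toLin' A.transpose '' (Set.univ.pi fun _ => Ioo 0 (1 / (n : ℝ))) ⊆
      WithLp.toLp 2 ⁻¹' L := by
    rintro _ ⟨c, hc, rfl⟩
    have h := hL.sum_smul_mem_of_zero_mem h0 (w := c) (fun i => (hc i trivial).1.le)
      ((Finset.sum_le_sum fun i _ => (hc i trivial).2.le).trans (by simp [hn'.ne'])) hA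
    rw [mem_preimage]
    convert h using 1
    ext j
    simp [Matrix.mulVec, dotProduct, mul_comm]
  have h1 := measure_mono (μ := volume) hsub
  rw [Measure.addHaar_image_linearMap, LinearMap.det_toLin', Matrix.det_transpose,
    Real.volume_pi_Ioo] at h1
  have h2 : volume (WithLp.toLp 2 ⁻¹' L) = volume L :=
    (EuclideanSpace.volume_preserving_symm_measurableEquiv_toLp (Fin n)).symm.measure_preimage_equiv L
  rw [h2] at h1
  have h3 := ENNReal.toReal_mono hb.measure_lt_top.ne h1
  rw [ENNReal.toReal_mul, ENNReal.toReal_ofReal (abs_nonneg _), ENNReal.toReal_prod] at h3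
  simp only [sub_zero, Finset.prod_const, Finset.card_univ, Fintype.card_fin] at h3
  rw [ENNReal.toReal_ofReal (by positivity), one_div, inv_pow, ← div_eq_mul_inv,
    div_le_iff₀ (by positivity)] at h3
  rw [mul_comm]
  exact h3

/-- A basis of maximal determinant with members in a given compact neighbourhood of the origin. -/
theorem IsCompact.exists_matrix_abs_vecMul_inv_le_one {n : ℕ} {L : Set (EuclideanSpace ℝ (Fin n))}
    (hL : IsCompact L) {ρ : ℝ} (hρ : 0 < ρ) (hball : closedBall 0 ρ ⊆ L) :
    ∃ A : Matrix (Fin n) (Fin n) ℝ, A.det ≠ 0 ∧ (∀ i, WithLp.toLp 2 (A i) ∈ L) ∧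
      ∀ x ∈ L, ∀ i, |Matrix.vecMul x.ofLp A⁻¹ i| ≤ 1 := by
  have hK : IsCompact (Set.univ.pi fun _ : Fin n => (WithLp.ofLp '' L : Set (Fin n → ℝ))) :=
    isCompact_univ_pi fun _ => hL.image (PiLp.continuous_ofLp 2 _)
  have hS : ∀ i, WithLp.toLp 2 ((ρ • (1 : Matrix (Fin n) (Fin n) ℝ)) i) ∈ L := fun i => by
    apply hball
    have : WithLp.toLp 2 ((ρ • (1 : Matrix (Fin n) (Fin n) ℝ)) i) =
        ρ • EuclideanSpace.single i (1 : ℝ) := by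
      ext j
      simp [Matrix.one_apply, eq_comm]
    rw [this, mem_closedBall_zero_iff, norm_smul]
    simp [abs_of_pos hρ]
  obtain ⟨A, hA, hmax⟩ := hK.exists_isMaxOn
    ⟨ρ • (1 : Matrix (Fin n) (Fin n) ℝ), fun i _ => ⟨_, hS i, rfl⟩⟩
    (f := fun A => |(Matrix.of A).det|)
    (Continuous.continuousOn (by
      refine continuous_abs.comp (Continuous.matrix_det ?_)
      exact continuous_id))
  have hA' : ∀ i, WithLp.toLp 2 (A i) ∈ L := fun i => by
    obtain ⟨y, hy, hyA⟩ := hA i trivial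
    rw [← hyA]; exact hy
  have hdet : (Matrix.of A).det ≠ 0 := fun h => by
    have h1 := hmax (a := ρ • (1 : Matrix (Fin n) (Fin n) ℝ)) (fun i _ => ⟨_, hS i, rfl⟩)
    simp only [h, abs_zero] at h1
    have h2 : (ρ • (1 : Matrix (Fin n) (Fin n) ℝ)).det ≠ 0 := by
      rw [Matrix.det_smul, Matrix.det_one]; positivity
    exact h2 (abs_nonpos_iff.1 h1)
  refine ⟨Matrix.of A, hdet, hA', fun x hx i => ?_⟩
  -- Exchanging row `i` for a point of `L` cannot increase `|det|`; by Cramer's rule the determinant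
  -- is multiplied by the `i`-th coordinate of `x` in the basis of rows.
  have h1 : |((Matrix.of A).updateRow i x.ofLp).det| ≤ |(Matrix.of A).det| := by
    refine hmax (a := (Matrix.of A).updateRow i x.ofLp) fun j _ => ?_
    rcases eq_or_ne j i with rfl | h
    · rw [Matrix.updateRow_self]
      exact ⟨x, hx, rfl⟩
    · rw [Matrix.updateRow_ne h]
      exact hA j trivial
  have h2 : ((Matrix.of A).updateRow i x.ofLp).det =
      (Matrix.of A).det * Matrix.vecMul x.ofLp (Matrix.of A)⁻¹ i := by
    rw [← Matrix.cramer_transpose_apply, Matrix.cramer_eq_adjugate_mulVec,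
      ← Matrix.adjugate_transpose, Matrix.mulVec_transpose, Matrix.inv_def, Ring.inverse_eq_inv',
      Matrix.vecMul_smul, Pi.smul_apply, smul_eq_mul, mul_inv_cancel_left₀ hdet]
  rw [h2, abs_mul] at h1
  exact (mul_le_iff_le_one_right (abs_pos.2 hdet)).1 h1

theorem EuclideanSpace.norm_le_card_mul {n : ℕ} {x : EuclideanSpace ℝ (Fin n)} {c : ℝ}
    (h : ∀ i, |x i| ≤ c) : ‖x‖ ≤ n * c := by
  have : x = ∑ i, x i • EuclideanSpace.single i (1 : ℝ) := by
    ext j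
    simp [Pi.single_apply]
  rw [this]
  refine (norm_sum_le _ _).trans ((Finset.sum_le_sum (g := fun _ => c) fun i _ => ?_).trans ?_)
  · simpa [norm_smul] using h i
  · simp

/-- A compact convex neighbourhood of the origin contains a basis whose coordinate functionals are
bounded by one on it; the basis vectors are controlled by the volume and the dual basis. -/
theorem IsCompact.exists_dual_bases {n : ℕ} (hn : 0 < n) {L : Set (EuclideanSpace ℝ (Fin n))}
    (hL : IsCompact L) (hconv : Convex ℝ L) {ρ : ℝ} (hρ : 0 < ρ) (hball : closedBall 0 ρ ⊆ L) :
    ∃ v g : Fin n → EuclideanSpace ℝ (Fin n), (∀ i, v i ∈ L) ∧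
      (∀ i j, inner ℝ (g i) (v j) = if j = i then 1 else 0) ∧
      (∀ x, ∑ i, inner ℝ (g i) x • v i = x) ∧ (∀ x ∈ L, ∀ i, |inner ℝ (g i) x| ≤ 1) ∧
      ∀ M > 0, (∀ i, ‖g i‖ ≤ M) → ∀ i,
        ‖v i‖ ≤ n * ((n : ℝ) ^ n * volume.real L * (n.factorial * M ^ n / M)) := by
  obtain ⟨A, hdet, hAL, hA⟩ := hL.exists_matrix_abs_vecMul_inv_le_one hρ hball
  have hu : IsUnit A.det := hdet.isUnit
  have hin : ∀ i (x : EuclideanSpace ℝ (Fin n)),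
      inner ℝ (WithLp.toLp 2 fun k => A⁻¹ k i) x = Matrix.vecMul x.ofLp A⁻¹ i := fun i x => by
    simp [PiLp.inner_apply, Matrix.vecMul, dotProduct]
  refine ⟨fun i => WithLp.toLp 2 (A i), fun i => WithLp.toLp 2 fun k => A⁻¹ k i, hAL,
    fun i j => ?_, fun x => ?_, fun x hx i => ?_, fun M hM hg i => ?_⟩
  · rw [hin, ← Matrix.one_apply, ← Matrix.mul_nonsing_inv _ hu]
    rfl
  · ext j
    have h : Matrix.vecMul (Matrix.vecMul x.ofLp A⁻¹) A j = x j := by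
      rw [Matrix.vecMul_vecMul, Matrix.nonsing_inv_mul _ hu, Matrix.vecMul_one]
    rw [← h]
    simp only [hin, WithLp.ofLp_sum, WithLp.ofLp_smul, Finset.sum_apply, Pi.smul_apply, smul_eq_mul]
    rfl
  · rw [hin]
    exact hA x hx i
  · refine EuclideanSpace.norm_le_card_mul fun j => ?_
    refine (Matrix.abs_apply_le_of_inv hdet hM (fun k l => ?_) i j).trans ?_
    · exact (PiLp.norm_apply_le (WithLp.toLp 2 fun k => A⁻¹ k l) k).trans (hg l)
    · gcongr
      exact hconv.abs_det_le_volume hn (hball (mem_closedBall_self hρ.le)) hL.isBounded hAL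

/-- The simplex spanned by the origin and a basis contains a ball about its centroid whose radius
is controlled by the dual basis. -/
theorem Convex.ball_centroid_subset {n : ℕ} (hn : 0 < n) {L : Set (EuclideanSpace ℝ (Fin n))}
    (hconv : Convex ℝ L) (h0 : 0 ∈ L) {v g : Fin n → EuclideanSpace ℝ (Fin n)}
    (hv : ∀ i, v i ∈ L) (hgv : ∀ i j, inner ℝ (g i) (v j) = if j = i then (1 : ℝ) else 0)
    (hx : ∀ x, ∑ i, inner ℝ (g i) x • v i = x) {M : ℝ} (hM : 0 < M) (hg : ∀ i, ‖g i‖ ≤ M) :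
    ball (((n : ℝ) + 1)⁻¹ • ∑ i, v i) (1 / (M * n * (n + 1))) ⊆ L := by
  have hn' : (0 : ℝ) < n := by exact_mod_cast hn
  intro x hxb
  set c := ((n : ℝ) + 1)⁻¹ • ∑ i, v i with hc
  rw [mem_ball, dist_eq_norm] at hxb
  have hgc : ∀ i, inner ℝ (g i) c = ((n : ℝ) + 1)⁻¹ := fun i => by
    rw [hc, inner_smul_right, inner_sum]
    simp [hgv]
  -- All coordinates of the centroid are `1/(n+1)`. A deviation of at most `1/(n(n+1))` keeps them
  -- nonnegative and their sum at most `1`, which fixes the radius.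
  have hd : ∀ i, |inner ℝ (g i) x - ((n : ℝ) + 1)⁻¹| ≤ 1 / (n * (n + 1)) := fun i => by
    rw [← hgc i, ← inner_sub_right]
    refine (abs_real_inner_le_norm _ _).trans ((mul_le_mul (hg i) hxb.le (norm_nonneg _) hM.le).trans
      (le_of_eq ?_))
    field_simp
  have hle : 1 / ((n : ℝ) * (n + 1)) ≤ ((n : ℝ) + 1)⁻¹ := by
    rw [← one_div]
    apply one_div_le_one_div_of_le (by positivity)
    have : (1 : ℝ) ≤ n := by exact_mod_cast hn
    nlinarith
  rw [← hx x]
  refine hconv.sum_smul_mem_of_zero_mem h0 (fun i => ?_) ?_ hv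
  · linarith [(abs_le.1 (hd i)).1]
  · calc ∑ i, inner ℝ (g i) x ≤ ∑ _i : Fin n, (((n : ℝ) + 1)⁻¹ + 1 / (n * (n + 1))) :=
        Finset.sum_le_sum fun i _ => by linarith [(abs_le.1 (hd i)).2]
      _ = 1 := by
        rw [Finset.sum_const, Finset.card_univ, Fintype.card_fin, nsmul_eq_mul]
        field_simp

/-! ### From the reverse isoperimetric inequality to the ball condition -/

open scoped Pointwise in
-- Convexity and `u 0 = 0` give `Ω_t ⊆ 2 Ω_{t/2}`.
theorem ConvexOn.volume_sublevelSet_le {n : ℕ} {u : EuclideanSpace ℝ (Fin n) → ℝ}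
    (hu : ConvexOn ℝ univ u) (h0 : u 0 = 0) {t : ℝ}
    (hb : Bornology.IsBounded (sublevelSet u (t / 2))) :
    volume.real (sublevelSet u t) ≤ 2 ^ n * volume.real (sublevelSet u (t / 2)) := by
  have hsub : sublevelSet u t ⊆ (2 : ℝ) • sublevelSet u (t / 2) := fun x hx => by
    refine ⟨(1 / 2 : ℝ) • x, ?_, by simp [smul_smul]⟩
    have h1 := hu.apply_smul_le h0 (c := 1 / 2) (by norm_num) (by norm_num) x
    have hx' : u x < t := hx
    show u ((1 / 2 : ℝ) • x) < t / 2
    linarith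
  have h : volume ((2 : ℝ) • sublevelSet u (t / 2)) =
      ENNReal.ofReal (2 ^ n) * volume (sublevelSet u (t / 2)) := by
    rw [Measure.addHaar_smul]
    simp
  have h1 := ENNReal.toReal_mono (by
    rw [h]; exact ENNReal.mul_ne_top ENNReal.ofReal_ne_top hb.measure_lt_top.ne)
    (measure_mono (μ := volume) hsub)
  rwa [h, ENNReal.toReal_mul, ENNReal.toReal_ofReal (by positivity)] at h1

/-- Under a reverse isoperimetric inequality, a linear functional bounded by `3` on the sublevel
set is controlled by the volume of that set. -/
theorem ReverseIsoperimetric.norm_le {n : ℕ} (hn : 2 ≤ n) {u : EuclideanSpace ℝ (Fin n) → ℝ}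
    (hu : ConvexOn ℝ univ u) (hc : Continuous u) (h0 : u 0 = 0) (hnn : ∀ x, 0 ≤ u x)
    {γ t : ℝ} (hγ : 0 < γ) (ht : 0 < t) (hb : Bornology.IsBounded (sublevelSet u t))
    (hV : 0 < volume.real (sublevelSet u t)) (hrev : ReverseIsoperimetric u γ t)
    {g : EuclideanSpace ℝ (Fin n)} (hg : ∀ x, u x < t → |inner ℝ g x| ≤ 3) :
    ‖g‖ ≤ 28 * 2 ^ n * γ * (volume.real (sublevelSet u t) ^ (1 / (n : ℝ)))⁻¹ := by
  set V := volume.real (sublevelSet u t) with hVdef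
  have hn1 : (1 : ℝ) < n := by exact_mod_cast hn
  rcases eq_or_ne g 0 with rfl | hg0
  · rw [norm_zero]; positivity
  have hgp : 0 < ‖g‖ := norm_pos_iff.2 hg0
  -- The shift raises `⟨g, ·⟩` by `7`, more than its oscillation on `Ω_t`, which is at most `6`.
  have hI := hu.volume_mul_le_norm_mul_integral_gradient hc (a := t / 2) (t := t) (by linarith) hb
    (v := (7 / ‖g‖ ^ 2) • g) (fun x hx => by
      by_contra! hlt
      have h1 := (abs_le.1 (hg x (by linarith))).1
      have h2 := (abs_le.1 (hg _ hlt)).2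
      rw [inner_add_right, inner_smul_right, real_inner_self_eq_norm_sq,
        div_mul_cancel₀ _ (by positivity)] at h2
      linarith)
  have hnorm : ‖(7 / ‖g‖ ^ 2) • g‖ = 7 / ‖g‖ := by
    rw [norm_smul, Real.norm_of_nonneg (by positivity)]
    field_simp
  rw [hnorm] at hI
  have hvol := hu.volume_sublevelSet_le h0 (t := t)
    (hb.subset fun x (hx : u x < t / 2) => show u x < t by linarith)
  -- Since `0 ≤ u`, the integrand is at most `t ^ (n/(n-1))`.
  have hR : (∫ x in sublevelSet u t, |t - u x| ^ ((n : ℝ) / ((n : ℝ) - 1))) ^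
      (((n : ℝ) - 1) / (n : ℝ)) ≤ t * V ^ (((n : ℝ) - 1) / (n : ℝ)) := by
    have hp : 0 ≤ (n : ℝ) / ((n : ℝ) - 1) := div_nonneg (by linarith) (by linarith)
    have h1 : ∫ x in sublevelSet u t, |t - u x| ^ ((n : ℝ) / ((n : ℝ) - 1)) ≤
        t ^ ((n : ℝ) / ((n : ℝ) - 1)) * V := by
      refine (Real.le_norm_self _).trans (norm_setIntegral_le_of_norm_le_const hb.measure_lt_top
        fun x hx => ?_)
      have hx' : u x < t := hx
      rw [Real.norm_of_nonneg (by positivity)]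
      exact Real.rpow_le_rpow (abs_nonneg _)
        (by rw [abs_of_pos (by linarith)]; linarith [hnn x]) hp
    refine (Real.rpow_le_rpow (integral_nonneg fun x => by positivity) h1
      (div_nonneg (by linarith) (by linarith))).trans (le_of_eq ?_)
    rw [Real.mul_rpow (by positivity) hV.le, ← Real.rpow_mul ht.le,
      div_mul_div_cancel₀ (by linarith), div_self (by linarith), Real.rpow_one]
  have hsplit : V = V ^ (((n : ℝ) - 1) / n) * V ^ (1 / (n : ℝ)) := by
    rw [← Real.rpow_add hV, ← add_div, sub_add_cancel, div_self (by linarith), Real.rpow_one]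
  set P := V ^ (((n : ℝ) - 1) / n) with hP
  set Q := V ^ (1 / (n : ℝ)) with hQ
  have hPp : 0 < P := Real.rpow_pos_of_pos hV _
  have hQp : 0 < Q := Real.rpow_pos_of_pos hV _
  have h2 : ∫ x in sublevelSet u t, ‖gradient u x‖ ≤ γ * (t * P) :=
    hrev.trans (mul_le_mul_of_nonneg_left hR hγ.le)
  have h3 : volume.real (sublevelSet u (t / 2)) * ((t - t / 2) / 2) ≤ 7 / ‖g‖ * (γ * (t * P)) :=
    hI.trans (mul_le_mul_of_nonneg_left h2 (by positivity))
  have h4 : V * ((t - t / 2) / 2) ≤ 2 ^ n * (7 / ‖g‖ * (γ * (t * P))) := by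
    refine (mul_le_mul_of_nonneg_right hvol (by linarith)).trans ?_
    rw [mul_assoc]
    exact mul_le_mul_of_nonneg_left h3 (by positivity)
  rw [← div_eq_mul_inv, le_div_iff₀ hQp]
  have h5 : ‖g‖ * Q * (t * P / 4) ≤ 28 * 2 ^ n * γ * (t * P / 4) := by
    rw [hsplit] at h4
    calc ‖g‖ * Q * (t * P / 4) = ‖g‖ * (P * Q * ((t - t / 2) / 2)) := by ring
      _ ≤ ‖g‖ * (2 ^ n * (7 / ‖g‖ * (γ * (t * P)))) := mul_le_mul_of_nonneg_left h4 hgp.le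
      _ = _ := by field_simp; ring
  exact le_of_mul_le_mul_right h5 (by positivity)

/-- A reverse isoperimetric inequality bounds the eccentricity of the sublevel set. -/
theorem ReverseIsoperimetric.exists_ball_subset {n : ℕ} (hn : 2 ≤ n)
    {u : EuclideanSpace ℝ (Fin n) → ℝ} (hu : ConvexOn ℝ univ u) (hc : Continuous u)
    (h0 : u 0 = 0) (hpos : ∀ x, x ≠ 0 → 0 < u x) {γ t : ℝ} (hγ : 0 < γ) (ht : 0 < t)
    (hrev : ReverseIsoperimetric u γ t) :
    ∃ (c : EuclideanSpace ℝ (Fin n)) (r d : ℝ), 0 < r ∧ r < d ∧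
      ball c r ⊆ {x | u x ≤ t / 3} ∧ sublevelSet u t ⊆ ball c d ∧
      d / r = 5 * n * (n * (n : ℝ) ^ n * n.factorial) * (n * (n + 1)) * (28 * 2 ^ n) ^ n * γ ^ n := by
  have hn0 : 0 < n := by omega
  have hn1 : (1 : ℝ) < n := by exact_mod_cast hn
  have hnn : ∀ x, 0 ≤ u x := fun x => by
    rcases eq_or_ne x 0 with rfl | hx
    · exact h0.ge
    · exact (hpos x hx).le
  have hb := hu.isBounded_sublevelSet hn0 hc h0 hpos t
  have hLsub : {x | u x ≤ t / 3} ⊆ sublevelSet u t := fun x (hx : u x ≤ t / 3) =>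
    show u x < t by linarith
  have hLc : IsCompact {x | u x ≤ t / 3} :=
    isCompact_of_isClosed_isBounded (isClosed_le hc continuous_const) (hb.subset hLsub)
  have hLconv : Convex ℝ {x | u x ≤ t / 3} := by
    simpa using hu.convex_le (t / 3)
  obtain ⟨ρ, hρ, hρL⟩ : ∃ ρ > 0, closedBall 0 ρ ⊆ {x | u x ≤ t / 3} := by
    have h := (isOpen_sublevelSet hc (t / 3)).mem_nhds (x := 0)
      (show u 0 < t / 3 by rw [h0]; positivity)
    obtain ⟨ρ, hρ, h⟩ := nhds_basis_closedBall.mem_iff.1 h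
    exact ⟨ρ, hρ, h.trans fun x (hx : u x < t / 3) => hx.le⟩
  have hV : 0 < volume.real (sublevelSet u t) :=
    ENNReal.toReal_pos ((isOpen_sublevelSet hc t).measure_pos volume
      ⟨0, show u 0 < t by rwa [h0]⟩).ne' hb.measure_lt_top.ne
  obtain ⟨v, g, hvL, hgv, hx, hgL, hvM⟩ := hLc.exists_dual_bases hn0 hLconv hρ hρL
  -- Contracting `Ω_t` by `1/3` about the origin puts it inside `{u ≤ t/3}`.
  have hg3 : ∀ i x, u x < t → |inner ℝ (g i) x| ≤ 3 := fun i x hxt => by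
    have h1 := hgL ((1 / 3 : ℝ) • x) (by
      have := hu.apply_smul_le h0 (c := 1 / 3) (by norm_num) (by norm_num) x
      show u ((1 / 3 : ℝ) • x) ≤ t / 3
      linarith) i
    rw [inner_smul_right, abs_mul, abs_of_pos (by norm_num : (0 : ℝ) < 1 / 3)] at h1
    linarith
  have hgM : ∀ i, ‖g i‖ ≤ _ := fun i => hrev.norm_le hn hu hc h0 hnn hγ ht hb hV (hg3 i)
  have hVL : volume.real {x | u x ≤ t / 3} ≤ volume.real (sublevelSet u t) :=
    ENNReal.toReal_mono hb.measure_lt_top.ne (measure_mono hLsub)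
  set V := volume.real (sublevelSet u t) with hVdef
  set M := 28 * 2 ^ n * γ * (V ^ (1 / (n : ℝ)))⁻¹ with hM
  have hMp : 0 < M := by positivity
  -- The volume cancels here, so the final ratio depends only on `n` and `γ`.
  have hMV : V * M ^ n = (28 * 2 ^ n) ^ n * γ ^ n := by
    rw [hM, mul_pow, mul_pow, inv_pow, ← Real.rpow_natCast (V ^ (1 / (n : ℝ))), ← Real.rpow_mul hV.le,
      one_div_mul_cancel (by linarith), Real.rpow_one]
    field_simp
  set d := (n : ℝ) * ((n : ℝ) ^ n * V * (n.factorial * M ^ n / M)) with hd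
  have hdp : 0 < d := by positivity
  have hvd : ∀ i, ‖v i‖ ≤ d := fun i => (hvM M hMp hgM i).trans (by rw [hd]; gcongr)
  -- From `⟨gᵢ, vᵢ⟩ = 1`; this forces the inner radius below the outer one, and ultimately `γ' > 1`.
  have hMd : 1 ≤ M * d := by
    have h1 := real_inner_le_norm (g ⟨0, hn0⟩) (v ⟨0, hn0⟩)
    rw [hgv, if_pos rfl] at h1
    exact h1.trans (mul_le_mul (hgM _) (hvd _) (norm_nonneg _) hMp.le)
  have hcn : ‖((n : ℝ) + 1)⁻¹ • ∑ i, v i‖ ≤ d := by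
    rw [norm_smul, norm_inv, Real.norm_of_nonneg (by positivity), inv_mul_le_iff₀ (by positivity)]
    refine (norm_sum_le _ _).trans ((Finset.sum_le_sum fun i _ => hvd i).trans ?_)
    simp only [Finset.sum_const, Finset.card_univ, Fintype.card_fin, nsmul_eq_mul]
    linarith
  -- Points of `Ω_t` have norm at most `3nd` and the centre at most `d`, so `5nd` is a sufficient
  -- outer radius.
  refine ⟨((n : ℝ) + 1)⁻¹ • ∑ i, v i, 1 / (M * n * (n + 1)), 5 * n * d, by positivity, ?_,
    hLconv.ball_centroid_subset hn0 (hρL (mem_closedBall_self hρ.le)) hvL hgv hx hMp hgM,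
    fun x hxt => ?_, ?_⟩
  · rw [div_lt_iff₀ (by positivity)]
    have : 1 ≤ (n : ℝ) * n * (n + 1) := by nlinarith
    nlinarith [mul_le_mul hMd this zero_le_one (by positivity)]
  · rw [mem_ball, dist_eq_norm]
    have h1 : ‖x‖ ≤ n * (3 * d) := by
      conv_lhs => rw [← hx x]
      refine (norm_sum_le _ _).trans ((Finset.sum_le_sum (g := fun _ => 3 * d) fun i _ => ?_).trans ?_)
      · rw [norm_smul]
        exact mul_le_mul (hg3 i x hxt) (hvd i) (norm_nonneg _) (by norm_num)
      · simp
    have h2 := norm_sub_le x (((n : ℝ) + 1)⁻¹ • ∑ i, v i)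
    nlinarith
  · rw [mul_assoc _ _ (γ ^ n), ← hMV, hd]
    field_simp

theorem theorem5p1 (n : ℕ) (hn : 2 ≤ n) :
    ∃ C : ℝ, 0 < C ∧
      ∀ (γ : ℝ), 0 < γ →
      ∀ (u : EuclideanSpace ℝ (Fin n) → ℝ),
        LocallyStrictConvex u → u 0 = 0 → HasGradientAt u 0 0 →
      ∀ (t : ℝ), 0 < t → ReverseIsoperimetric u γ t →
        ∃ t' ∈ Set.Ioo (t / 3) (t / 2),
          SatisfiesBallCondition (C * γ ^ ((n : ℝ) / 2)) (sublevelSet u t') := by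
  have hn0 : 0 < n := by omega
  set K : ℝ := 5 * n * (n * (n : ℝ) ^ n * n.factorial) * (n * (n + 1)) * (28 * 2 ^ n) ^ n with hK
  have hKp : 0 < K := by positivity
  refine ⟨√K, Real.sqrt_pos.2 hKp, fun γ hγ u hu h0 hg t ht hrev => ?_⟩
  have hc := hu.continuous
  have hconv := hu.convexOn hc
  have hpos : ∀ x, x ≠ 0 → 0 < u x := fun x hx => hu.pos h0 hg hx
  obtain ⟨c, r, d, hr, hrd, hball, hsub, hdr⟩ :=
    hrev.exists_ball_subset hn hconv hc h0 hpos hγ ht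
  set γ' := √K * γ ^ ((n : ℝ) / 2) with hγ'
  have hγp : 0 < γ' := by positivity
  -- With `R = γ' r` this makes the inner radius `R / γ'` equal to `r` and the outer radius `γ' R`
  -- equal to `d`.
  have hsq : γ' ^ 2 = d / r := by
    rw [hdr, hγ', mul_pow, Real.sq_sqrt hKp.le, ← Real.rpow_natCast (γ ^ _), ← Real.rpow_mul hγ.le,
      Nat.cast_ofNat, div_mul_cancel₀ _ two_ne_zero, Real.rpow_natCast]
  -- Any level in `(t/3, t/2)` would do: its sublevel set lies between `{u ≤ t/3}` and `Ω_t`.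
  refine ⟨2 * t / 5, ⟨by linarith, by linarith⟩, ?_, isOpen_sublevelSet hc _,
    by simpa [sublevelSet] using hconv.convex_lt (2 * t / 5),
    hconv.isBounded_sublevelSet hn0 hc h0 hpos _, c, γ' * r, by positivity, ?_, ?_⟩
  · have : 1 < γ' ^ 2 := by rw [hsq, one_lt_div hr]; exact hrd
    nlinarith
  · rw [inv_mul_cancel_left₀ hγp.ne']
    exact hball.trans fun x (hx : u x ≤ t / 3) => show u x < 2 * t / 5 by linarith
  · rw [← mul_assoc, ← sq, hsq, div_mul_cancel₀ _ hr.ne']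
    exact fun x (hx : u x < 2 * t / 5) => hsub (show u x < t by linarith)
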